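/- Let $X$ be a finite non-empty set, let $\mathcal K$ be a finite-dimensional complex Hilbert space, let $\mathcal S(\mathcal K)$ be the set of quantum states (density operators) on $\mathcal K$, and let $E : X \to \mathcal S(\mathcal K)$, $x \mapsto \rho_x$, be an encoding. For a probability distribution $\mu = (p_x)_{x\in X}$ on $X$ let $I_\mu(E) = S(A)+S(B)-S(AB)$ be the quantum mutual information (with the von Neumann entropy $S(\rho) = -\operatorname{Tr}\rho\log_2\rho$) between the two systems $A$, $B$ of the bipartite state $\sum_{x\in X} p_x\,|x\rangle\langle x|\otimes\rho_x$, and let the maximum possible information in $E$ be $T(E) = \max_\mu I_\mu(E)$. In the remote state preparation problem $\mathrm{RSP}(X,E,\epsilon)$ Alice gets an input $x\in X$. Alice and Bob share an arbitrary finite-dimensional bipartite state that does not depend on $x$ (prior entanglement), and run a two-way quantum communication protocol of finitely many rounds: in each round one of them applies a quantum operation (which may depend on $x$ if it is Alice's) to the register that he or she holds, and sends some number of qubits, fixed by the protocol, to the other. At the end Bob applies a quantum operation to his register and must hold a state $\sigma_x\in\mathcal S(\mathcal K)$ with fidelity $F(\sigma_x,\rho_x) = \operatorname{Tr}\sqrt{\sqrt{\sigma_x}\,\rho_x\sqrt{\sigma_x}}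 \ge 1-\epsilon$, for every $x \in X$. Let $Q^{pub}(\mathrm{RSP}(X,E,\epsilon))$ be the least total number of qubits, counted in both directions, exchanged by a protocol that solves $\mathrm{RSP}(X,E,\epsilon)$. Then $$Q^{pub}(\mathrm{RSP}(X,E,0)) \;\ge\; \frac{T(E)}{2}.$$ -/

import Mathlib

open scoped Kronecker Matrix ENNReal ComplexOrder

namespace RSP

universe u v

/-- A quantum state of the finite-dimensional Hilbert space `ℂ^n`: a positive semidefinite matrix
of trace one. -/
structure State (n : Type*) [Fintype n] where
  mat : Matrix n n ℂ
  posSemidef : mat.PosSemidef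
  trace_eq_one : mat.trace = 1

/-- The reduced matrix on the second factor (trace out the first factor). -/
def traceFst {A B : Type*} [Fintype A] (M : Matrix (A × B) (A × B) ℂ) : Matrix B B ℂ :=
  Matrix.of fun b b' => ∑ a, M (a, b) (a, b')

/-- The reduced matrix on the first factor (trace out the second factor). -/
def traceSnd {A B : Type*} [Fintype B] (M : Matrix (A × B) (A × B) ℂ) : Matrix A A ℂ :=
  Matrix.of fun a a' => ∑ b, M (a, b) (a', b)

/-- The von Neumann entropy `- Tr ρ log₂ ρ`, in bits. -/
noncomputable def entropy {n : Type*} [Fintype n] [DecidableEq n] (ρ : Matrix n n ℂ) : ℝ :=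
  (cfc Real.negMulLog ρ).trace.re / Real.log 2

/-- The quantum mutual information `I(A : B) = S(A) + S(B) - S(AB)` of a bipartite state. -/
noncomputable def mutualInfo {A B : Type*} [Fintype A] [DecidableEq A] [Fintype B] [DecidableEq B]
    (ρ : Matrix (A × B) (A × B) ℂ) : ℝ :=
  entropy (traceSnd ρ) + entropy (traceFst ρ) - entropy ρ

/-- The fidelity `F(ρ, σ) = Tr √(√ρ σ √ρ)`. -/
noncomputable def fidelity {n : Type*} [Fintype n] [DecidableEq n] (ρ σ : Matrix n n ℂ) : ℝ :=
  (cfc Real.sqrt (cfc Real.sqrt ρ * σ * cfc Real.sqrt ρ)).trace.re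

open scoped Matrix.Norms.L2Operator in
theorem continuous_entropy {n Y : Type*} [Fintype n] [DecidableEq n] [TopologicalSpace Y]
    {M : Y → Matrix n n ℂ} (hM : Continuous M) (h : ∀ y, (M y).IsHermitian) :
    Continuous fun y => entropy (M y) := by
  have hc : Continuous fun y => cfc Real.negMulLog (M y) :=
    Continuous.cfc_of_mem_nhdsSet (s := Set.univ) Real.negMulLog Filter.univ_mem hM
      (fun y => h y) Real.continuous_negMulLog.continuousOn
  unfold entropy
  exact (Complex.continuous_re.comp hc.matrix_trace).div_const _

section Encoding

variable {X : Type u} {K : Type v} [Fintype X] [DecidableEq X] [Fintype K] [DecidableEq K]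

/-- The classical-quantum state `∑ x, μ(x) |x⟩⟨x| ⊗ E(x)`. -/
noncomputable def cqState (E : X → State K) (μ : X → ℝ) : Matrix (X × K) (X × K) ℂ :=
  ∑ x, (μ x : ℂ) • (Matrix.single x x (1 : ℂ) ⊗ₖ (E x).mat)

/-- The mutual information between the two systems of `cqState E μ`. -/
noncomputable def info (E : X → State K) (μ : X → ℝ) : ℝ :=
  mutualInfo (cqState E μ)

/-- The maximum possible information in the encoding `E`: the maximum of `info E μ` over all
probability distributions `μ` on `X` (attained, see `isGreatest_maxInfo`). -/
noncomputable def maxInfo (E : X → State K) : ℝ :=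
  sSup (info E '' stdSimplex ℝ X)

/-- The maximum in the definition of `maxInfo` exists. -/
theorem isGreatest_maxInfo [Nonempty X] (E : X → State K) :
    IsGreatest (info E '' stdSimplex ℝ X) (maxInfo E) := by
  have hH : ∀ μ : X → ℝ, (cqState E μ).IsHermitian := by
    intro μ
    unfold cqState Matrix.IsHermitian
    simp [Matrix.conjTranspose_sum, Matrix.conjTranspose_smul, Matrix.conjTranspose_kronecker,
      fun x => (E x).posSemidef.1.eq]
  have hc : Continuous (cqState E) := by
    unfold cqState
    fun_prop
  have h1 : Continuous (info E) := by
    unfold info mutualInfo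
    refine ((continuous_entropy ?_ ?_).add (continuous_entropy ?_ ?_)).sub
      (continuous_entropy hc hH)
    · refine continuous_matrix fun a a' => continuous_finsetSum _ fun b _ => ?_
      exact hc.matrix_elem _ _
    · intro μ
      ext a a'
      simp only [traceSnd, Matrix.conjTranspose_apply, Matrix.of_apply, star_sum, (hH μ).apply]
    · refine continuous_matrix fun a a' => continuous_finsetSum _ fun b _ => ?_
      exact hc.matrix_elem _ _
    · intro μ
      ext a a'
      simp only [traceFst, Matrix.conjTranspose_apply, Matrix.of_apply, star_sum, (hH μ).apply]
  have hne : (stdSimplex ℝ X).Nonempty := Set.nonempty_coe_sort.mp inferInstance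
  exact ((isCompact_stdSimplex ℝ X).image h1).isGreatest_sSup (hne.image _)

end Encoding

/-- A quantum channel from `ℂ^m` to `ℂ^n` (a completely positive trace-preserving map), given by
Kraus operators. -/
structure Channel (m n : Type*) [Fintype m] [DecidableEq m] [Fintype n] where
  rank : ℕ
  kraus : Fin rank → Matrix n m ℂ
  sum_eq_one : ∑ i, (kraus i)ᴴ * kraus i = 1

namespace Channel

variable {m n A B : Type*} [Fintype m] [DecidableEq m] [Fintype n]

/-- The action of a channel. -/
def apply (Φ : Channel m n) (ρ : Matrix m m ℂ) : Matrix n n ℂ :=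
  ∑ i, Φ.kraus i * ρ * (Φ.kraus i)ᴴ

/-- The action `Φ ⊗ id` of a channel on the first factor of a bipartite system. -/
def applyFst [Fintype B] [DecidableEq B] (Φ : Channel m n) (ρ : Matrix (m × B) (m × B) ℂ) :
    Matrix (n × B) (n × B) ℂ :=
  ∑ i, (Φ.kraus i ⊗ₖ (1 : Matrix B B ℂ)) * ρ * (Φ.kraus i ⊗ₖ (1 : Matrix B B ℂ))ᴴ

/-- The action `id ⊗ Φ` of a channel on the second factor of a bipartite system. -/
def applySnd [Fintype A] [DecidableEq A] (Φ : Channel m n) (ρ : Matrix (A × m) (A × m) ℂ) :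
    Matrix (A × n) (A × n) ℂ :=
  ∑ i, ((1 : Matrix A A ℂ) ⊗ₖ Φ.kraus i) * ρ * ((1 : Matrix A A ℂ) ⊗ₖ Φ.kraus i)ᴴ

end Channel

/-- The basis labels of a register of `q` qubits, whose Hilbert space is `(ℂ²)^{⊗ q}`. -/
abbrev Qubits (q : ℕ) : Type := Fin q → Fin 2

/-- The remaining part of a two-way quantum communication protocol in which Alice has a classical
input in `X`, she currently holds a register `A`, Bob holds a register `B`, and Bob has to output a
state of `ℂ^K`.

* `output Φ`: the communication is over; Bob applies `Φ` to his register and outputs the result.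
* `aliceSends q Φ P`: on input `x` Alice applies `Φ x` to her register, which produces a new
  register `A'` that she keeps and `q` qubits that she sends to Bob; then they go on with `P`.
* `bobSends q Φ P`: Bob applies `Φ` to his register, which produces a new register `B'` that he
  keeps and `q` qubits that he sends to Alice; then they go on with `P`. -/
inductive Rounds (X : Type u) (K : Type v) [Fintype K] :
    (A B : Type) → [Fintype A] → [DecidableEq A] → [Fintype B] → [DecidableEq B] →
      Type (max u v 1)
  | output {A B : Type} [Fintype A] [DecidableEq A] [Fintype B] [DecidableEq B]
      (Φ : Channel B K) : Rounds X K A B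
  | aliceSends {A B A' : Type} [Fintype A] [DecidableEq A] [Fintype B] [DecidableEq B]
      [Fintype A'] [DecidableEq A'] (q : ℕ) (Φ : X → Channel A (A' × Qubits q))
      (P : Rounds X K A' (Qubits q × B)) : Rounds X K A B
  | bobSends {A B B' : Type} [Fintype A] [DecidableEq A] [Fintype B] [DecidableEq B]
      [Fintype B'] [DecidableEq B'] (q : ℕ) (Φ : Channel B (Qubits q × B'))
      (P : Rounds X K (A × Qubits q) B') : Rounds X K A B

namespace Rounds

variable {X : Type u} {K : Type v} [Fintype K]

/-- The total number of qubits that are exchanged, in both directions. -/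
def cost : {A B : Type} → [Fintype A] → [DecidableEq A] → [Fintype B] → [DecidableEq B] →
    Rounds X K A B → ℕ
  | _, _, _, _, _, _, @output _ _ _ _ _ _ _ _ _ _ => 0
  | _, _, _, _, _, _, @aliceSends _ _ _ _ _ _ _ _ _ _ _ _ q _ P => q + P.cost
  | _, _, _, _, _, _, @bobSends _ _ _ _ _ _ _ _ _ _ _ _ q _ P => q + P.cost

/-- Bob's output on Alice's input `x`, when the joint state of both registers is `ρ`. -/
noncomputable def run (x : X) : {A B : Type} → [Fintype A] → [DecidableEq A] → [Fintype B] →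
    [DecidableEq B] → Rounds X K A B → Matrix (A × B) (A × B) ℂ → Matrix K K ℂ
  | _, _, _, _, _, _, @output _ _ _ _ _ _ _ _ _ Φ, ρ => Φ.apply (traceFst ρ)
  | _, _, _, _, _, _, @aliceSends _ _ _ _ _ _ _ _ _ _ _ _ _ Φ P, ρ =>
      P.run x (Matrix.reindex (Equiv.prodAssoc _ _ _) (Equiv.prodAssoc _ _ _) ((Φ x).applyFst ρ))
  | _, _, _, _, _, _, @bobSends _ _ _ _ _ _ _ _ _ _ _ _ _ Φ P, ρ =>
      P.run x (Matrix.reindex (Equiv.prodAssoc _ _ _).symm (Equiv.prodAssoc _ _ _).symm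
        (Φ.applySnd ρ))

end Rounds

/-- A protocol with prior entanglement: an arbitrary bipartite state shared by Alice and Bob, which
does not depend on Alice's input, followed by finitely many rounds of communication. -/
structure Protocol (X : Type u) (K : Type v) [Fintype K] where
  A : Type
  B : Type
  [fintypeA : Fintype A]
  [decEqA : DecidableEq A]
  [fintypeB : Fintype B]
  [decEqB : DecidableEq B]
  shared : State (A × B)
  rounds : Rounds X K A B

section Complexity

variable {X : Type u} {K : Type v} [Fintype K] [DecidableEq K]

/-- The number of qubits exchanged by the protocol. -/
def Protocol.cost (P : Protocol X K) : ℕ :=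
  letI := P.fintypeA
  letI := P.decEqA
  letI := P.fintypeB
  letI := P.decEqB
  P.rounds.cost

/-- Bob's final state on Alice's input `x`. -/
noncomputable def Protocol.result (P : Protocol X K) (x : X) : Matrix K K ℂ :=
  letI := P.fintypeA
  letI := P.decEqA
  letI := P.fintypeB
  letI := P.decEqB
  P.rounds.run x P.shared.mat

/-- The protocol solves the remote state preparation problem for the encoding `E` with error `ε`:
on every input `x` the fidelity of Bob's final state with `E x` is at least `1 - ε`. -/
def Protocol.Solves (P : Protocol X K) (E : X → State K) (ε : ℝ) : Prop :=
  ∀ x, 1 - ε ≤ fidelity (P.result x) (E x).mat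

/-- The communication complexity, with prior entanglement, of remote state preparation for the
encoding `E` with error `ε`: the least number of qubits exchanged by a protocol that solves the
problem (`⊤` if there were none). -/
noncomputable def Qpub (E : X → State K) (ε : ℝ) : ℕ∞ :=
  ⨅ (P : Protocol X K) (_ : P.Solves E ε), (P.cost : ℕ∞)

end Complexity

end RSP

/-!
An exact protocol yields a single positive operator `τ` with `E x ≤ τ` for every input `x` and
`Tr τ = 4 ^ q`, where `q` is the number of qubits sent by Alice. Indeed `ρ ≤ dim A • (1 ⊗ Tr_A ρ)`
for positive `ρ` on `A ⊗ B`, so Bob may replace each message of `q` qubits from Alice by `2 ^ q`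
times the identity: he then needs no input, his final operator dominates the true output for every
`x`, and each such message multiplies the trace by `4 ^ q`. The true output on input `x` is `E x`,
because two states of fidelity one are equal.

Let `σ = ∑ x, μ x • E x`. The information satisfies
`log 2 * I_μ(E) = ∑ x, μ x * D(E x‖τ) - D(σ‖τ)`. Here `D(E x‖τ) ≤ 0` since `E x ≤ τ`, and
`D(σ‖τ) ≥ -log Tr τ` by Klein's inequality, so `I_μ(E) ≤ log₂ Tr τ = 2 * q`.
-/

namespace RSP

open Matrix Polynomial Filter Topology

open scoped MatrixOrder

section TraceOfFunctionalCalculus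

variable {n : Type*} [Fintype n] [DecidableEq n] {A B : Matrix n n ℂ}

theorem continuousOn_spectrum (f : ℝ → ℝ) (A : Matrix n n ℂ) : ContinuousOn f (spectrum ℝ A) :=
  finite_real_spectrum.continuousOn f

theorem cfc_eq_unitary_mul_diagonal_mul (hA : A.IsHermitian) (f : ℝ → ℝ) :
    cfc f A = (hA.eigenvectorUnitary : Matrix n n ℂ) *
      diagonal (fun i => (f (hA.eigenvalues i) : ℂ)) *
        (hA.eigenvectorUnitary : Matrix n n ℂ)ᴴ := by
  rw [hA.cfc_eq, IsHermitian.cfc, Unitary.conjStarAlgAut_apply]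
  rfl

theorem cfc_mul_cfc (f g : ℝ → ℝ) (A : Matrix n n ℂ) :
    cfc f A * cfc g A = cfc (fun x => f x * g x) A :=
  (cfc_mul f g A (continuousOn_spectrum f A) (continuousOn_spectrum g A)).symm

theorem mul_cfc_self (hA : A.IsHermitian) (f : ℝ → ℝ) :
    A * cfc f A = cfc (fun x => x * f x) A := by
  conv_lhs => enter [1]; rw [← cfc_id' ℝ A hA]
  exact cfc_mul_cfc _ f A

theorem cfc_congr_of_eigenvalues (hA : A.IsHermitian) {f g : ℝ → ℝ}
    (h : ∀ i, f (hA.eigenvalues i) = g (hA.eigenvalues i)) : cfc f A = cfc g A := by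
  refine cfc_congr fun x hx => ?_
  obtain ⟨i, rfl⟩ := hA.spectrum_real_eq_range_eigenvalues ▸ hx
  exact h i

theorem trace_cfc (hA : A.IsHermitian) (f : ℝ → ℝ) :
    (cfc f A).trace = ∑ i, (f (hA.eigenvalues i) : ℂ) := by
  have hU : (hA.eigenvectorUnitary : Matrix n n ℂ)ᴴ * hA.eigenvectorUnitary = 1 :=
    Unitary.coe_star_mul_self _
  rw [cfc_eq_unitary_mul_diagonal_mul hA, trace_mul_cycle, hU, one_mul, trace_diagonal]

theorem trace_cfc_eq_sum_roots_charpoly (hA : A.IsHermitian) (f : ℝ → ℝ) :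
    (cfc f A).trace = (A.charpoly.roots.map fun z => (f z.re : ℂ)).sum := by
  rw [trace_cfc hA, hA.roots_charpoly_eq_eigenvalues, Multiset.map_map]
  rfl

theorem trace_cfc_diagonal (d : n → ℝ) (f : ℝ → ℝ) :
    (cfc f (diagonal fun i => (d i : ℂ))).trace = ∑ i, (f (d i) : ℂ) := by
  have hd : (diagonal fun i => (d i : ℂ)).IsHermitian :=
    isHermitian_diagonal_of_self_adjoint _ (funext fun i => Complex.conj_ofReal (d i))
  rw [trace_cfc_eq_sum_roots_charpoly hd, charpoly_diagonal,
    roots_prod _ _ (Finset.prod_ne_zero_iff.mpr fun i _ => X_sub_C_ne_zero _)]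
  simp

theorem trace_cfc_reindex {m : Type*} [Fintype m] [DecidableEq m] (e : n ≃ m)
    (hA : A.IsHermitian) (f : ℝ → ℝ) : (cfc f (reindex e e A)).trace = (cfc f A).trace := by
  have hA' : (reindex e e A).IsHermitian := hA.submatrix _
  rw [trace_cfc_eq_sum_roots_charpoly hA', trace_cfc_eq_sum_roots_charpoly hA, charpoly_reindex]

theorem charpoly_blockDiagonal {R ι : Type*} [CommRing R] [Fintype ι] [DecidableEq ι]
    (M : ι → Matrix n n R) : (blockDiagonal M).charpoly = ∏ i, (M i).charpoly := by
  have h : charmatrix (blockDiagonal M) = blockDiagonal fun i => charmatrix (M i) := by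
    ext ⟨k, i⟩ ⟨l, j⟩ : 2
    by_cases hij : i = j
    · subst hij
      simp [charmatrix_apply, blockDiagonal_apply, diagonal_apply]
    · simp [blockDiagonal_apply, hij]
  rw [charpoly, h, det_blockDiagonal]
  rfl

theorem trace_cfc_blockDiagonal {ι : Type*} [Fintype ι] [DecidableEq ι] {M : ι → Matrix n n ℂ}
    (hM : ∀ i, (M i).IsHermitian) (f : ℝ → ℝ) :
    (cfc f (blockDiagonal M)).trace = ∑ i, (cfc f (M i)).trace := by
  rw [trace_cfc_eq_sum_roots_charpoly (isHermitian_blockDiagonal_iff.mpr hM),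
    charpoly_blockDiagonal,
    roots_prod _ _ (Finset.prod_ne_zero_iff.mpr fun i _ => (charpoly_monic (M i)).ne_zero),
    Multiset.map_bind, Multiset.sum_bind]
  exact Finset.sum_congr rfl fun i _ => (trace_cfc_eq_sum_roots_charpoly (hM i) f).symm

theorem trace_cfc_mul_cfc (hA : A.IsHermitian) (hB : B.IsHermitian) (f g : ℝ → ℝ) :
    (cfc f A * cfc g B).trace = ∑ i, ∑ j, ((f (hA.eigenvalues i) * g (hB.eigenvalues j) *
      ‖((hA.eigenvectorUnitary : Matrix n n ℂ)ᴴ * hB.eigenvectorUnitary) i j‖ ^ 2 : ℝ) : ℂ) := by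
  rw [cfc_eq_unitary_mul_diagonal_mul hA, cfc_eq_unitary_mul_diagonal_mul hB]
  set U := (hA.eigenvectorUnitary : Matrix n n ℂ)
  set W := (hB.eigenvectorUnitary : Matrix n n ℂ)
  set D := diagonal (fun i => (f (hA.eigenvalues i) : ℂ))
  set D' := diagonal (fun i => (g (hB.eigenvalues i) : ℂ))
  have hcycle : (U * D * Uᴴ * (W * D' * Wᴴ)).trace = (D * (Uᴴ * W) * D' * (Uᴴ * W)ᴴ).trace := by
    rw [conjTranspose_mul, conjTranspose_conjTranspose]
    simp only [Matrix.mul_assoc]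
    rw [trace_mul_comm]
    simp only [Matrix.mul_assoc]
  rw [hcycle, trace]
  refine Finset.sum_congr rfl fun i _ => ?_
  rw [diag_apply, mul_apply]
  refine Finset.sum_congr rfl fun j _ => ?_
  rw [mul_diagonal, diagonal_mul, conjTranspose_apply, Complex.star_def]
  push_cast
  rw [← Complex.mul_conj']
  ring

theorem klein_inequality {ι : Type*} [Fintype ι] (hA : A.IsHermitian) (hB : B.IsHermitian)
    (f g : ι → ℝ → ℝ)
    (h : ∀ i j, 0 ≤ ∑ k, f k (hA.eigenvalues i) * g k (hB.eigenvalues j)) :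
    0 ≤ ∑ k, (cfc (f k) A * cfc (g k) B).trace.re := by
  simp only [trace_cfc_mul_cfc hA hB, ← Complex.ofReal_sum, Complex.ofReal_re]
  rw [Finset.sum_comm]
  refine Finset.sum_nonneg fun i _ => ?_
  rw [Finset.sum_comm]
  refine Finset.sum_nonneg fun j _ => ?_
  rw [← Finset.sum_mul]
  exact mul_nonneg (h i j) (sq_nonneg _)

end TraceOfFunctionalCalculus

theorem re_trace_le_re_trace {n : Type*} [Fintype n] {A B : Matrix n n ℂ} (h : A ≤ B) :
    A.trace.re ≤ B.trace.re := by
  have hBA := (Complex.le_def.mp (Matrix.le_iff.mp h).trace_nonneg).1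
  rwa [trace_sub, Complex.sub_re, Complex.zero_re, sub_nonneg] at hBA

section RelativeEntropy

variable {n : Type*} [Fintype n] [DecidableEq n] {ρ ω : Matrix n n ℂ}

/-- The quantum relative entropy `D(ρ‖ω) = Tr ρ (log ρ - log ω)`, in nats. It has its usual meaning
for positive definite `ω`; on the kernel of `ω` the junk value `Real.log 0 = 0` replaces the value
`D(ρ‖ω) = ∞`. -/
noncomputable def relEntropy (ρ ω : Matrix n n ℂ) : ℝ :=
  (ρ * (cfc Real.log ρ - cfc Real.log ω)).trace.re

theorem log_two_mul_entropy (hρ : ρ.IsHermitian) :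
    Real.log 2 * entropy ρ = -(ρ * cfc Real.log ρ).trace.re := by
  rw [entropy, mul_div_cancel₀ _ (Real.log_pos one_lt_two).ne', mul_cfc_self hρ, ← Complex.neg_re,
    ← trace_neg, ← cfc_neg]
  simp only [Real.negMulLog_eq_neg]

theorem relEntropy_eq (hρ : ρ.IsHermitian) (ω : Matrix n n ℂ) :
    relEntropy ρ ω = -(Real.log 2 * entropy ρ) - (ρ * cfc Real.log ω).trace.re := by
  rw [relEntropy, mul_sub, trace_sub, Complex.sub_re, log_two_mul_entropy hρ, neg_neg]

theorem cfc_log_smul (hω : ω.PosDef) {c : ℝ} (hc : 0 < c) :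
    cfc Real.log (c • ω) = Real.log c • 1 + cfc Real.log ω := by
  have hωH : IsSelfAdjoint ω := hω.1
  have hlog : cfc (fun w => Real.log (c * w)) ω = cfc (fun w => Real.log c + Real.log w) ω :=
    cfc_congr_of_eigenvalues hω.1 fun i => Real.log_mul hc.ne' (hω.eigenvalues_pos i).ne'
  rw [← Algebra.algebraMap_eq_smul_one,
    ← cfc_const_add _ _ ω (continuousOn_spectrum _ _), ← hlog]
  exact (cfc_comp_const_mul c Real.log ω ((finite_real_spectrum.image _).continuousOn _)).symm

theorem relEntropy_smul_right (ρ : Matrix n n ℂ) (hω : ω.PosDef) {c : ℝ} (hc : 0 < c) :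
    relEntropy ρ (c • ω) = relEntropy ρ ω - Real.log c * ρ.trace.re := by
  simp only [relEntropy, cfc_log_smul hω hc, mul_sub, mul_add, Matrix.mul_smul, mul_one, trace_sub,
    trace_add, trace_smul, Complex.sub_re, Complex.add_re, Complex.smul_re, smul_eq_mul]
  ring

theorem mul_log_sub_nonneg {r w : ℝ} (hr : 0 ≤ r) (hw : 0 < w) :
    0 ≤ r * Real.log r - r * Real.log w - r + w := by
  rcases hr.eq_or_lt with rfl | hr
  · simpa using hw.le
  · have hlog := Real.log_le_sub_one_of_pos (div_pos hw hr)
    rw [Real.log_div hw.ne' hr.ne'] at hlog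
    have hmul : r * (w / r) = w := mul_div_cancel₀ w hr.ne'
    linarith [mul_le_mul_of_nonneg_left hlog hr.le]

theorem mul_log_sub_le {r w : ℝ} (hr : 0 ≤ r) (hw : 0 < w) :
    r * Real.log r - r * Real.log w ≤ r * r * w⁻¹ - r := by
  rcases hr.eq_or_lt with rfl | hr
  · simp
  · have hlog := Real.log_le_sub_one_of_pos (div_pos hr hw)
    rw [Real.log_div hr.ne' hw.ne', div_eq_mul_inv] at hlog
    linarith [mul_le_mul_of_nonneg_left hlog hr.le]

theorem trace_sub_trace_le_relEntropy (hρ : 0 ≤ ρ) (hω : ω.PosDef) :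
    ρ.trace.re - ω.trace.re ≤ relEntropy ρ ω := by
  have hρS : IsSelfAdjoint ρ := hρ.posSemidef.1
  have hωS : IsSelfAdjoint ω := hω.1
  have hklein := klein_inequality hρS hωS
    ![fun r => r * Real.log r, fun r => r, fun r => r, fun _ => 1]
    ![fun _ => 1, fun w => -Real.log w, fun _ => -1, fun w => w] fun i j => by
      simpa [Fin.sum_univ_four, sub_eq_add_neg] using
        mul_log_sub_nonneg (hρ.posSemidef.eigenvalues_nonneg i) (hω.eigenvalues_pos j)
  simp only [Nat.succ_eq_add_one, Nat.reduceAdd, Fin.sum_univ_four, Fin.isValue, cons_val_zero,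
    cfc_const_one ℝ ω, mul_one, cons_val_one, cfc_id' ℝ ρ, cfc_neg, mul_neg, trace_neg,
    Complex.neg_re, cons_val, cfc_const_one ℝ ρ, cfc_id' ℝ ω, one_mul] at hklein
  rw [relEntropy, mul_sub, mul_cfc_self hρS, trace_sub, Complex.sub_re]
  linarith

theorem neg_log_trace_le_relEntropy (hρ : 0 ≤ ρ) (hρ1 : ρ.trace = 1) (hω : ω.PosDef) :
    -Real.log ω.trace.re ≤ relEntropy ρ ω := by
  have hn : Nonempty n := by
    by_contra hn
    rw [not_nonempty_iff] at hn
    simp [trace] at hρ1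
  have hc : 0 < ω.trace.re := (Complex.lt_def.mp hω.trace_pos).1
  have hle := trace_sub_trace_le_relEntropy hρ (hω.smul (inv_pos.mpr hc))
  rw [relEntropy_smul_right ρ hω (inv_pos.mpr hc), hρ1, trace_smul, Complex.smul_re, smul_eq_mul,
    inv_mul_cancel₀ hc.ne', Complex.one_re, Real.log_inv] at hle
  linarith

theorem mul_inv_mul_le (hρ : 0 ≤ ρ) (hω : ω.PosDef) (h : ρ ≤ ω) : ρ * ω⁻¹ * ρ ≤ ρ := by
  have hdet : IsUnit ω.det := (isUnit_iff_isUnit_det ω).mp hω.isUnit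
  have hρH : ρᴴ = ρ := hρ.posSemidef.1
  have hωH : (ω⁻¹)ᴴ = ω⁻¹ := hω.inv.1
  have hsplit : ρ - ρ * ω⁻¹ * ρ = (1 - ρ * ω⁻¹) * ρ * (1 - ρ * ω⁻¹)ᴴ +
      (ρ * ω⁻¹) * (ω - ρ) * (ρ * ω⁻¹)ᴴ := by
    have hcancel : ρ * ω⁻¹ * ω = ρ := nonsing_inv_mul_cancel_right ω ρ hdet
    rw [conjTranspose_sub, conjTranspose_one, conjTranspose_mul, hρH, hωH, mul_sub (ρ * ω⁻¹),
      hcancel]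
    noncomm_ring
  rw [Matrix.le_iff, hsplit]
  exact (hρ.posSemidef.mul_mul_conjTranspose_same _).add
    ((Matrix.le_iff.mp h).mul_mul_conjTranspose_same _)

theorem cfc_inv_eq_inv (hω : ω.PosDef) : cfc (fun w : ℝ => w⁻¹) ω = ω⁻¹ := by
  refine (inv_eq_right_inv ?_).symm
  rw [mul_cfc_self hω.1, ← cfc_const_one ℝ ω hω.1]
  exact cfc_congr_of_eigenvalues hω.1 fun i => mul_inv_cancel₀ (hω.eigenvalues_pos i).ne'

-- `log x ≤ x - 1` gives `D(ρ‖ω) ≤ Tr ρ ω⁻¹ ρ - Tr ρ`; operator monotonicity of `log` is avoided.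
theorem relEntropy_nonpos_of_le (hρ : 0 ≤ ρ) (hω : ω.PosDef) (h : ρ ≤ ω) :
    relEntropy ρ ω ≤ 0 := by
  have hρS : IsSelfAdjoint ρ := hρ.posSemidef.1
  have hωS : IsSelfAdjoint ω := hω.1
  have hklein := klein_inequality hρS hωS
    ![fun r => r * r, fun r => r, fun r => r, fun r => r * Real.log r]
    ![fun w => w⁻¹, fun _ => -1, Real.log, fun _ => -1] fun i j => by
      have := mul_log_sub_le (hρ.posSemidef.eigenvalues_nonneg i) (hω.eigenvalues_pos j)
      simpa [Fin.sum_univ_four, add_comm, add_left_comm, add_assoc] using by linarith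
  have hsq : cfc (fun r : ℝ => r * r) ρ = ρ * ρ := by rw [← mul_cfc_self hρS, cfc_id' ℝ ρ]
  have hle := re_trace_le_re_trace (mul_inv_mul_le hρ hω h)
  rw [trace_mul_comm, ← Matrix.mul_assoc] at hle
  simp only [Nat.succ_eq_add_one, Nat.reduceAdd, Fin.sum_univ_four, Fin.isValue, cons_val_zero, hsq,
    cfc_inv_eq_inv hω, cons_val_one, cfc_id' ℝ ρ, cfc_neg, cfc_const_one ℝ ω, mul_neg, mul_one,
    trace_neg, Complex.neg_re, cons_val] at hklein
  rw [relEntropy, mul_sub, mul_cfc_self hρS, trace_sub, Complex.sub_re]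
  linarith

end RelativeEntropy

section HolevoInformation

variable {X K : Type*} [Fintype X] [Fintype K]

/-- The state `∑ x, μ(x) E(x)` that Bob holds when Alice's input is drawn from `μ`. -/
def averageState (E : X → State K) (μ : X → ℝ) : Matrix K K ℂ :=
  ∑ x, (μ x : ℂ) • (E x).mat

theorem averageState_nonneg (E : X → State K) {μ : X → ℝ} (hμ : ∀ x, 0 ≤ μ x) :
    0 ≤ averageState E μ :=
  (posSemidef_sum _ fun x _ => (E x).posSemidef.smul (by simpa using hμ x)).nonneg

theorem trace_averageState (E : X → State K) (μ : X → ℝ) :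
    (averageState E μ).trace = ((∑ x, μ x : ℝ) : ℂ) := by
  simp [averageState, trace_sum, trace_smul, (E _).trace_eq_one]

variable [DecidableEq X]

theorem cqState_eq_reindex (E : X → State K) (μ : X → ℝ) :
    cqState E μ = reindex (Equiv.prodComm K X) (Equiv.prodComm K X)
      (blockDiagonal fun x => (μ x : ℂ) • (E x).mat) := by
  ext ⟨x, k⟩ ⟨y, l⟩
  simp [cqState, Matrix.sum_apply, single_apply, blockDiagonal_apply, ite_and]

theorem traceSnd_cqState (E : X → State K) (μ : X → ℝ) :
    traceSnd (cqState E μ) = diagonal fun x => (μ x : ℂ) := by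
  ext x y
  have htrace : ∑ k, (E x).mat k k = 1 := (E x).trace_eq_one
  by_cases hxy : x = y
  · subst hxy
    simp [traceSnd, cqState_eq_reindex, ← Finset.mul_sum, htrace]
  · simp [traceSnd, cqState_eq_reindex, blockDiagonal_apply, hxy]

theorem traceFst_cqState (E : X → State K) (μ : X → ℝ) :
    traceFst (cqState E μ) = averageState E μ := by
  ext k l
  simp [traceFst, averageState, cqState_eq_reindex, blockDiagonal_apply, Matrix.sum_apply]

variable [DecidableEq K]

theorem entropy_smul {ρ : Matrix K K ℂ} (hρ : ρ.IsHermitian) (p : ℝ) :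
    entropy ((p : ℂ) • ρ) = ρ.trace.re * (Real.negMulLog p / Real.log 2) + p * entropy ρ := by
  have hsmul : cfc Real.negMulLog ((p : ℂ) • ρ) = cfc (fun r => Real.negMulLog (p * r)) ρ :=
    (cfc_comp_const_mul p Real.negMulLog ρ ((finite_real_spectrum.image _).continuousOn _) hρ).symm
  have htrace : ρ.trace.re = ∑ i, hρ.eigenvalues i := by
    simp [hρ.trace_eq_sum_eigenvalues]
  rw [entropy, entropy, hsmul, trace_cfc hρ, trace_cfc hρ, htrace]
  simp only [Complex.re_sum, Complex.ofReal_re, Real.negMulLog_mul, Finset.sum_add_distrib,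
    ← Finset.sum_mul, ← Finset.mul_sum]
  ring

theorem entropy_cqState (E : X → State K) (μ : X → ℝ) :
    entropy (cqState E μ) =
      entropy (diagonal fun x => (μ x : ℂ)) + ∑ x, μ x * entropy (E x).mat := by
  have hblocks : entropy (cqState E μ) = ∑ x, entropy ((μ x : ℂ) • (E x).mat) := by
    have hH := fun x => (E x).posSemidef.1.smul (Complex.conj_ofReal (μ x))
    simp only [entropy, cqState_eq_reindex, trace_cfc_blockDiagonal hH,
      trace_cfc_reindex _ (isHermitian_blockDiagonal_iff.mpr hH), Complex.re_sum, Finset.sum_div]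
  have hdiag : entropy (diagonal fun x => (μ x : ℂ)) = ∑ x, Real.negMulLog (μ x) / Real.log 2 := by
    simp only [entropy, trace_cfc_diagonal, Complex.re_sum, Complex.ofReal_re, Finset.sum_div]
  simp only [hblocks, hdiag, entropy_smul (E _).posSemidef.1, (E _).trace_eq_one, Complex.one_re,
    one_mul, Finset.sum_add_distrib]

theorem info_eq_entropy_sub (E : X → State K) (μ : X → ℝ) :
    info E μ = entropy (averageState E μ) - ∑ x, μ x * entropy (E x).mat := by
  rw [info, mutualInfo, traceSnd_cqState, traceFst_cqState, entropy_cqState]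
  ring

theorem log_two_mul_info (E : X → State K) (μ : X → ℝ) (ω : Matrix K K ℂ) :
    Real.log 2 * info E μ =
      ∑ x, μ x * relEntropy (E x).mat ω - relEntropy (averageState E μ) ω := by
  have hH : (averageState E μ).IsHermitian := isSelfAdjoint_sum _ fun x _ =>
    (E x).posSemidef.1.smul (Complex.conj_ofReal (μ x))
  have hlinear : (averageState E μ * cfc Real.log ω).trace.re =
      ∑ x, μ x * ((E x).mat * cfc Real.log ω).trace.re := by
    simp [averageState, Finset.sum_mul, trace_sum]
  simp only [relEntropy_eq (E _).posSemidef.1, relEntropy_eq hH, info_eq_entropy_sub, mul_sub,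
    hlinear, Finset.mul_sum, Finset.sum_sub_distrib, mul_neg, Finset.sum_neg_distrib,
    mul_left_comm (Real.log 2)]
  ring

theorem two_rpow_info_le_trace_of_posDef (E : X → State K) {μ : X → ℝ} (hμ : μ ∈ stdSimplex ℝ X)
    {ω : Matrix K K ℂ} (hω : ω.PosDef) (h : ∀ x, (E x).mat ≤ ω) :
    (2 : ℝ) ^ info E μ ≤ ω.trace.re := by
  have hsum : ∑ x, μ x * relEntropy (E x).mat ω ≤ 0 :=
    Finset.sum_nonpos fun x _ => mul_nonpos_of_nonneg_of_nonpos (hμ.1 x)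
      (relEntropy_nonpos_of_le (E x).posSemidef.nonneg hω (h x))
  have havg : -Real.log ω.trace.re ≤ relEntropy (averageState E μ) ω :=
    neg_log_trace_le_relEntropy (averageState_nonneg E hμ.1) (by simp [trace_averageState, hμ.2]) hω
  have hlog : Real.log 2 * info E μ ≤ Real.log ω.trace.re := by
    linarith [log_two_mul_info E μ ω]
  obtain ⟨x, -⟩ := Finset.exists_ne_zero_of_sum_ne_zero (hμ.2.trans_ne one_ne_zero)
  have hone : 1 ≤ ω.trace.re := by
    simpa only [(E x).trace_eq_one, Complex.one_re] using re_trace_le_re_trace (h x)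
  rwa [Real.rpow_def_of_pos two_pos, ← Real.le_log_iff_exp_le (zero_lt_one.trans_le hone)]

theorem two_rpow_info_le_trace (E : X → State K) {μ : X → ℝ} (hμ : μ ∈ stdSimplex ℝ X)
    {τ : Matrix K K ℂ} (h : ∀ x, (E x).mat ≤ τ) : (2 : ℝ) ^ info E μ ≤ τ.trace.re := by
  obtain ⟨x, -⟩ := Finset.exists_ne_zero_of_sum_ne_zero (hμ.2.trans_ne one_ne_zero)
  have hτ : 0 ≤ τ := (E x).posSemidef.nonneg.trans (h x)
  have hperturbed : ∀ δ > 0, (2 : ℝ) ^ info E μ ≤ τ.trace.re + δ * Fintype.card K := by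
    intro δ hδ
    have hδ1 : (δ • (1 : Matrix K K ℂ)).PosDef := PosDef.one.smul hδ
    have := two_rpow_info_le_trace_of_posDef E hμ (PosDef.posSemidef_add hτ.posSemidef hδ1)
      fun x => (h x).trans (le_add_of_nonneg_right hδ1.posSemidef.nonneg)
    simpa [trace_add, trace_smul] using this
  have hlim : Tendsto (fun δ : ℝ => τ.trace.re + δ * Fintype.card K) (𝓝[>] 0) (𝓝 τ.trace.re) := by
    have : ContinuousAt (fun δ : ℝ => τ.trace.re + δ * Fintype.card K) 0 := by fun_prop
    simpa [ContinuousAt] using this.mono_left nhdsWithin_le_nhds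
  exact ge_of_tendsto hlim (eventually_mem_nhdsWithin.mono hperturbed)

end HolevoInformation

section Fidelity

theorem exists_linearIsometry_apply_eq {𝕜 V W : Type*} [RCLike 𝕜] [NormedAddCommGroup V]
    [InnerProductSpace 𝕜 V] [FiniteDimensional 𝕜 V] [AddCommGroup W] [Module 𝕜 W]
    {f g : W →ₗ[𝕜] V} (h : ∀ w, ‖f w‖ = ‖g w‖) : ∃ L : V →ₗᵢ[𝕜] V, ∀ w, L (f w) = g w := by
  have hker : f.ker ≤ g.ker := fun w hw => by
    rw [LinearMap.mem_ker, ← norm_eq_zero] at hw ⊢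
    rwa [← h w]
  let L₀ : f.range →ₗ[𝕜] V := f.ker.liftQ g hker ∘ₗ f.quotKerEquivRange.symm.toLinearMap
  have hL₀ : ∀ w, L₀ ⟨f w, f.mem_range_self w⟩ = g w := fun w => by
    simp [L₀, LinearMap.quotKerEquivRange_symm_apply_image]
  let L₁ : f.range →ₗᵢ[𝕜] V := ⟨L₀, by
    rintro ⟨_, w, rfl⟩
    rw [hL₀, Submodule.coe_norm, h w]⟩
  exact ⟨L₁.extend, fun w => (L₁.extend_apply ⟨f w, f.mem_range_self w⟩).trans (hL₀ w)⟩

theorem norm_apply_eq_of_star_mul_self_eq {𝕜 V : Type*} [RCLike 𝕜] [NormedAddCommGroup V]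
    [InnerProductSpace 𝕜 V] [CompleteSpace V] {S T : V →L[𝕜] V} (h : star S * S = star T * T)
    (v : V) : ‖S v‖ = ‖T v‖ := by
  rw [ContinuousLinearMap.apply_norm_eq_sqrt_inner_adjoint_left,
    ContinuousLinearMap.apply_norm_eq_sqrt_inner_adjoint_left]
  exact congrArg (fun R : V →L[𝕜] V => √(RCLike.re (inner 𝕜 (R v) v))) h

theorem exists_unitary_mul_eq {𝕜 n : Type*} [RCLike 𝕜] [Fintype n] [DecidableEq n]
    {A B : Matrix n n 𝕜} (h : Aᴴ * A = Bᴴ * B) : ∃ U ∈ unitaryGroup n 𝕜, U * A = B := by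
  let e : Matrix n n 𝕜 ≃⋆ₐ[𝕜] (EuclideanSpace 𝕜 n →L[𝕜] EuclideanSpace 𝕜 n) := toEuclideanCLM
  have hnorm : ∀ v, ‖e A v‖ = ‖e B v‖ := norm_apply_eq_of_star_mul_self_eq <| by
    simpa only [← star_eq_conjTranspose, map_mul, map_star] using congrArg e h
  obtain ⟨L, hL⟩ := exists_linearIsometry_apply_eq (f := (e A).toLinearMap)
    (g := (e B).toLinearMap) hnorm
  have hisometry : star L.toContinuousLinearMap * L.toContinuousLinearMap = 1 :=
    ContinuousLinearMap.norm_map_iff_adjoint_comp_self _ |>.mp L.norm_map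
  have hU : e (e.symm L.toContinuousLinearMap) = L.toContinuousLinearMap := e.apply_symm_apply _
  refine ⟨e.symm L.toContinuousLinearMap, mem_unitaryGroup_iff'.mpr ?_, ?_⟩
  · apply EquivLike.injective e
    rw [map_mul, map_star, hU, hisometry, map_one]
  · apply EquivLike.injective e
    rw [map_mul, hU]
    exact ContinuousLinearMap.ext hL

variable {n : Type*} [Fintype n] [DecidableEq n] {ρ σ : Matrix n n ℂ}

theorem cfc_sqrt_mul_self (hρ : 0 ≤ ρ) : cfc Real.sqrt ρ * cfc Real.sqrt ρ = ρ := by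
  have hρS : IsSelfAdjoint ρ := hρ.posSemidef.1
  rw [cfc_mul_cfc]
  refine (cfc_congr_of_eigenvalues hρ.posSemidef.1 fun i =>
    Real.mul_self_sqrt (hρ.posSemidef.eigenvalues_nonneg i)).trans (cfc_id' ℝ ρ)

theorem conjTranspose_cfc (f : ℝ → ℝ) (ρ : Matrix n n ℂ) : (cfc f ρ)ᴴ = cfc f ρ :=
  cfc_predicate f ρ

theorem exists_unitary_fidelity_eq (σ : Matrix n n ℂ) (hρ : 0 ≤ ρ) : ∃ U ∈ unitaryGroup n ℂ,
    fidelity σ ρ = (U * (cfc Real.sqrt ρ * cfc Real.sqrt σ)).trace.re := by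
  have hnonneg : 0 ≤ cfc Real.sqrt σ * ρ * cfc Real.sqrt σ := by
    simpa only [conjTranspose_cfc] using
      (hρ.posSemidef.mul_mul_conjTranspose_same (cfc Real.sqrt σ)).nonneg
  obtain ⟨U, hU, hpolar⟩ := exists_unitary_mul_eq
    (A := cfc Real.sqrt ρ * cfc Real.sqrt σ)
    (B := cfc Real.sqrt (cfc Real.sqrt σ * ρ * cfc Real.sqrt σ)) <| by
    rw [conjTranspose_mul, conjTranspose_cfc, conjTranspose_cfc, conjTranspose_cfc,
      cfc_sqrt_mul_self hnonneg, Matrix.mul_assoc, ← Matrix.mul_assoc (cfc Real.sqrt ρ),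
      cfc_sqrt_mul_self hρ, ← Matrix.mul_assoc]
  exact ⟨U, hU, by rw [fidelity, hpolar]⟩

theorem eq_of_trace_add_trace_le_two_mul_fidelity (hσ : 0 ≤ σ) (hρ : 0 ≤ ρ)
    (h : σ.trace.re + ρ.trace.re ≤ 2 * fidelity σ ρ) : σ = ρ := by
  obtain ⟨U, hU, hF⟩ := exists_unitary_fidelity_eq σ hρ
  have hUU : Uᴴ * U = 1 := mem_unitaryGroup_iff'.mp hU
  set S := cfc Real.sqrt σ
  set R := cfc Real.sqrt ρ
  have hS : Sᴴ = S := conjTranspose_cfc _ σ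
  have hR : Rᴴ = R := conjTranspose_cfc _ ρ
  have hSS : S * S = σ := cfc_sqrt_mul_self hσ
  have hRUUR : (U * R)ᴴ * (U * R) = ρ := by
    rw [conjTranspose_mul, hR, Matrix.mul_assoc, ← Matrix.mul_assoc Uᴴ, hUU, one_mul]
    exact cfc_sqrt_mul_self hρ
  have hcross : (S * (U * R)).trace.re = fidelity σ ρ := by
    rw [hF, trace_mul_comm, Matrix.mul_assoc]
  have hcross' : ((U * R)ᴴ * S).trace.re = fidelity σ ρ := by
    rw [← hcross, ← Complex.conj_re, ← Complex.star_def, ← trace_conjTranspose, conjTranspose_mul,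
      hS, conjTranspose_conjTranspose]
  have hexpand : ((S - U * R)ᴴ * (S - U * R)).trace.re =
      σ.trace.re + ρ.trace.re - 2 * fidelity σ ρ := by
    simp only [conjTranspose_sub, hS, sub_mul, mul_sub, hSS, hRUUR, trace_sub, Complex.sub_re,
      hcross, hcross']
    ring
  have hzero : ((S - U * R)ᴴ * (S - U * R)).trace = 0 := by
    obtain ⟨hre, him⟩ :=
      Complex.le_def.mp (posSemidef_conjTranspose_mul_self (S - U * R)).trace_nonneg
    exact Complex.ext (le_antisymm (by rw [hexpand]; exact sub_nonpos.mpr h) hre) him.symm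
  have hSUR : S = U * R := sub_eq_zero.mp (trace_conjTranspose_mul_self_eq_zero_iff.mp hzero)
  calc σ = Sᴴ * S := by rw [hS, hSS]
    _ = ρ := by rw [hSUR, hRUUR]

end Fidelity

theorem sum_mul_mul_conjTranspose_sum_le {𝕜 ι m n : Type*} [RCLike 𝕜] [Fintype ι] [Fintype m]
    [Finite n] {ρ : Matrix m m 𝕜} (hρ : 0 ≤ ρ) (T : ι → Matrix n m 𝕜) :
    (∑ i, T i) * ρ * (∑ i, T i)ᴴ ≤ Fintype.card ι • ∑ i, T i * ρ * (T i)ᴴ := by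
  cases nonempty_fintype n
  have hcross : ∑ i, ∑ j, T i * ρ * (T j)ᴴ = (∑ i, T i) * ρ * (∑ i, T i)ᴴ := by
    simp only [← Matrix.mul_sum, ← Matrix.sum_mul, ← conjTranspose_sum]
  have hcross' : ∑ i, ∑ j, T j * ρ * (T i)ᴴ = (∑ i, T i) * ρ * (∑ i, T i)ᴴ := by
    rw [Finset.sum_comm, hcross]
  have hvariance : Fintype.card ι • ∑ i, T i * ρ * (T i)ᴴ - (∑ i, T i) * ρ * (∑ i, T i)ᴴ =
      (2⁻¹ : ℝ) • ∑ i, ∑ j, (T i - T j) * ρ * (T i - T j)ᴴ := by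
    simp only [conjTranspose_sub, Matrix.mul_sub, Matrix.sub_mul, Finset.sum_sub_distrib, hcross,
      hcross', Finset.sum_const, Finset.card_univ, ← Finset.smul_sum]
    module
  rw [← sub_nonneg, hvariance]
  exact smul_nonneg (by positivity) <| Finset.sum_nonneg fun i _ => Finset.sum_nonneg fun j _ =>
    (hρ.posSemidef.mul_mul_conjTranspose_same _).nonneg

theorem kronecker_le_kronecker_left {𝕜 m n : Type*} [RCLike 𝕜] [Finite m] [Finite n]
    {M : Matrix m m 𝕜} {ρ σ : Matrix n n 𝕜} (hM : 0 ≤ M) (h : ρ ≤ σ) : M ⊗ₖ ρ ≤ M ⊗ₖ σ := by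
  rw [← add_sub_cancel ρ σ, kronecker_add]
  exact le_add_of_nonneg_right (hM.posSemidef.kronecker (Matrix.le_iff.mp h)).nonneg

theorem sum_single_kronecker {R m n p : Type*} [Semiring R] [Fintype m] [DecidableEq m]
    (M : Matrix n p R) : ∑ i : m, single i i (1 : R) ⊗ₖ M = (1 : Matrix m m R) ⊗ₖ M := by
  ext i j
  simp only [← sum_single_one, Matrix.sum_apply, kroneckerMap_apply, Finset.sum_mul]

theorem trace_reindex {R m n : Type*} [AddCommMonoid R] [Fintype m] [Fintype n] (e : m ≃ n)
    (M : Matrix m m R) : (reindex e e M).trace = M.trace :=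
  e.symm.sum_comp fun i => M i i

section PartialTrace

variable {A B C : Type*} [Fintype A]

theorem traceFst_eq_sum_submatrix (ρ : Matrix (A × B) (A × B) ℂ) :
    traceFst ρ = ∑ a, ρ.submatrix (Prod.mk a) (Prod.mk a) := by
  ext b b'
  simp [traceFst, Matrix.sum_apply]

theorem traceFst_mono {ρ σ : Matrix (A × B) (A × B) ℂ} (h : ρ ≤ σ) : traceFst ρ ≤ traceFst σ := by
  rw [traceFst_eq_sum_submatrix, traceFst_eq_sum_submatrix]
  exact Finset.sum_le_sum fun a _ => (Matrix.le_iff.mp h).submatrix (Prod.mk a)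

theorem traceFst_nonneg {ρ : Matrix (A × B) (A × B) ℂ} (hρ : 0 ≤ ρ) : 0 ≤ traceFst ρ := by
  rw [traceFst_eq_sum_submatrix]
  exact Finset.sum_nonneg fun a _ => (hρ.posSemidef.submatrix (Prod.mk a)).nonneg

theorem trace_traceFst [Fintype B] (ρ : Matrix (A × B) (A × B) ℂ) :
    (traceFst ρ).trace = ρ.trace := by
  simp only [trace, diag_apply, traceFst, of_apply, Fintype.sum_prod_type]
  exact Finset.sum_comm

theorem traceFst_reindex_prodAssoc [Fintype B] (ρ : Matrix ((A × B) × C) ((A × B) × C) ℂ) :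
    traceFst (traceFst (reindex (Equiv.prodAssoc A B C) (Equiv.prodAssoc A B C) ρ)) =
      traceFst ρ := by
  ext c c'
  simp only [traceFst, of_apply, reindex_apply, submatrix_apply, Equiv.prodAssoc_symm_apply,
    Fintype.sum_prod_type]
  exact Finset.sum_comm

theorem traceFst_reindex_prodAssoc_symm [Fintype B]
    (ρ : Matrix (A × B × C) (A × B × C) ℂ) :
    traceFst (reindex (Equiv.prodAssoc A B C).symm (Equiv.prodAssoc A B C).symm ρ) =
      traceFst (traceFst ρ) := by
  ext c c'
  simp only [traceFst, of_apply, reindex_apply, submatrix_apply, Equiv.symm_symm,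
    Equiv.prodAssoc_apply, Fintype.sum_prod_type]
  exact Finset.sum_comm

variable [DecidableEq A]

theorem single_kronecker_one_mul_mul [Fintype B] [DecidableEq B] (a : A)
    (ρ : Matrix (A × B) (A × B) ℂ) :
    (single a a (1 : ℂ) ⊗ₖ (1 : Matrix B B ℂ)) * ρ * (single a a (1 : ℂ) ⊗ₖ (1 : Matrix B B ℂ))ᴴ =
      single a a (1 : ℂ) ⊗ₖ ρ.submatrix (Prod.mk a) (Prod.mk a) := by
  ext ⟨i, b⟩ ⟨j, c⟩
  simp only [mul_apply, Fintype.sum_prod_type, conjTranspose_kronecker, conjTranspose_one,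
      conjTranspose_single, star_one, kroneckerMap_apply, one_apply, single_apply, submatrix_apply]
  by_cases hi : a = i <;> by_cases hj : a = j <;> simp [hi, hj, ite_and]

theorem le_card_smul_one_kronecker_traceFst [Finite B] {ρ : Matrix (A × B) (A × B) ℂ}
    (hρ : 0 ≤ ρ) : ρ ≤ Fintype.card A • ((1 : Matrix A A ℂ) ⊗ₖ traceFst ρ) := by
  classical
  cases nonempty_fintype B
  have hblock : ∀ a, ρ.submatrix (Prod.mk a) (Prod.mk a) ≤ traceFst ρ := fun a => by
    rw [traceFst_eq_sum_submatrix]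
    exact Finset.single_le_sum (fun a _ => (hρ.posSemidef.submatrix (Prod.mk a)).nonneg)
      (Finset.mem_univ a)
  calc ρ ≤ Fintype.card A • ∑ a : A, single a a (1 : ℂ) ⊗ₖ ρ.submatrix (Prod.mk a) (Prod.mk a) := by
        have hpinching := sum_mul_mul_conjTranspose_sum_le hρ
          fun a : A => single a a (1 : ℂ) ⊗ₖ (1 : Matrix B B ℂ)
        simpa only [sum_single_kronecker, one_kronecker_one, conjTranspose_one, one_mul, mul_one,
          single_kronecker_one_mul_mul] using hpinching
    _ ≤ Fintype.card A • ∑ a : A, single a a (1 : ℂ) ⊗ₖ traceFst ρ := by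
        gcongr with a
        rw [← diagonal_single]
        exact kronecker_le_kronecker_left
          (PosSemidef.diagonal (Pi.single_nonneg.mpr zero_le_one)).nonneg (hblock a)
    _ = Fintype.card A • ((1 : Matrix A A ℂ) ⊗ₖ traceFst ρ) := by
        rw [sum_single_kronecker]

end PartialTrace

namespace Channel

variable {m n A B : Type*} [Fintype m] [DecidableEq m] [Fintype n]

theorem apply_nonneg (Φ : Channel m n) {ρ : Matrix m m ℂ} (hρ : 0 ≤ ρ) : 0 ≤ Φ.apply ρ :=
  Finset.sum_nonneg fun i _ => (hρ.posSemidef.mul_mul_conjTranspose_same (Φ.kraus i)).nonneg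

theorem apply_mono (Φ : Channel m n) {ρ σ : Matrix m m ℂ} (h : ρ ≤ σ) :
    Φ.apply ρ ≤ Φ.apply σ := by
  have hsub : Φ.apply (σ - ρ) = Φ.apply σ - Φ.apply ρ := by
    simp only [apply, Matrix.mul_sub, Matrix.sub_mul, Finset.sum_sub_distrib]
  rw [← sub_nonneg, ← hsub]
  exact Φ.apply_nonneg (sub_nonneg.mpr h)

theorem trace_apply (Φ : Channel m n) (ρ : Matrix m m ℂ) : (Φ.apply ρ).trace = ρ.trace := by
  have hcycle : ∀ i, (Φ.kraus i * ρ * (Φ.kraus i)ᴴ).trace =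
      ((Φ.kraus i)ᴴ * Φ.kraus i * ρ).trace :=
    fun i => by rw [trace_mul_comm, Matrix.mul_assoc]
  simp only [apply, trace_sum, hcycle]
  rw [← trace_sum, ← Matrix.sum_mul, Φ.sum_eq_one, one_mul]

theorem applyFst_nonneg [Fintype B] [DecidableEq B] (Φ : Channel m n)
    {ρ : Matrix (m × B) (m × B) ℂ} (hρ : 0 ≤ ρ) : 0 ≤ Φ.applyFst ρ :=
  Finset.sum_nonneg fun _ _ => (hρ.posSemidef.mul_mul_conjTranspose_same _).nonneg

theorem applySnd_nonneg [Fintype A] [DecidableEq A] (Φ : Channel m n)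
    {ρ : Matrix (A × m) (A × m) ℂ} (hρ : 0 ≤ ρ) : 0 ≤ Φ.applySnd ρ :=
  Finset.sum_nonneg fun _ _ => (hρ.posSemidef.mul_mul_conjTranspose_same _).nonneg

theorem traceFst_applyFst [Fintype B] [DecidableEq B] (Φ : Channel m n)
    (ρ : Matrix (m × B) (m × B) ℂ) : traceFst (Φ.applyFst ρ) = traceFst ρ := by
  ext b b'
  have hblock : ∀ i c, ((Φ.kraus i ⊗ₖ (1 : Matrix B B ℂ)) * ρ *
        (Φ.kraus i ⊗ₖ (1 : Matrix B B ℂ))ᴴ) (c, b) (c, b') =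
      (Φ.kraus i * ρ.submatrix (·, b) (·, b') * (Φ.kraus i)ᴴ) c c := by
    intro i c
    simp [mul_apply, Fintype.sum_prod_type, conjTranspose_kronecker, one_apply]
  calc traceFst (Φ.applyFst ρ) b b' = (Φ.apply (ρ.submatrix (·, b) (·, b'))).trace := by
        simp only [traceFst, of_apply, applyFst, apply, trace, diag_apply, Matrix.sum_apply, hblock]
    _ = traceFst ρ b b' := Φ.trace_apply _

theorem traceFst_applySnd [Fintype A] [DecidableEq A] (Φ : Channel m n)
    (ρ : Matrix (A × m) (A × m) ℂ) : traceFst (Φ.applySnd ρ) = Φ.apply (traceFst ρ) := by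
  ext b b'
  have hblock : ∀ i a, (((1 : Matrix A A ℂ) ⊗ₖ Φ.kraus i) * ρ *
        ((1 : Matrix A A ℂ) ⊗ₖ Φ.kraus i)ᴴ) (a, b) (a, b') =
      (Φ.kraus i * ρ.submatrix (Prod.mk a) (Prod.mk a) * (Φ.kraus i)ᴴ) b b' := by
    intro i a
    simp [mul_apply, Fintype.sum_prod_type, conjTranspose_kronecker, one_apply]
  rw [traceFst_eq_sum_submatrix ρ]
  simp only [apply, traceFst, of_apply, applySnd, Matrix.sum_apply, hblock, Matrix.mul_sum,
    Matrix.sum_mul]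
  exact Finset.sum_comm

end Channel

namespace Rounds

variable {X K : Type*} [Fintype K]

theorem run_nonneg (x : X) {A B : Type} [Fintype A] [DecidableEq A] [Fintype B] [DecidableEq B]
    (P : Rounds X K A B) {ρ : Matrix (A × B) (A × B) ℂ} (hρ : 0 ≤ ρ) : 0 ≤ P.run x ρ := by
  induction P with
  | output Φ => exact Φ.apply_nonneg (traceFst_nonneg hρ)
  | aliceSends _ Φ _ ih => exact ih (((Φ x).applyFst_nonneg hρ).posSemidef.submatrix _).nonneg
  | bobSends _ Φ _ ih => exact ih ((Φ.applySnd_nonneg hρ).posSemidef.submatrix _).nonneg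

theorem trace_run (x : X) {A B : Type} [Fintype A] [DecidableEq A] [Fintype B] [DecidableEq B]
    (P : Rounds X K A B) (ρ : Matrix (A × B) (A × B) ℂ) : (P.run x ρ).trace = ρ.trace := by
  induction P with
  | output Φ => rw [run, Φ.trace_apply, trace_traceFst]
  | aliceSends _ Φ _ ih =>
    rw [run, ih, trace_reindex, ← trace_traceFst, (Φ x).traceFst_applyFst, trace_traceFst]
  | bobSends _ Φ _ ih =>
    rw [run, ih, trace_reindex, ← trace_traceFst, Φ.traceFst_applySnd, Φ.trace_apply,
      trace_traceFst]

/-- The number of qubits sent from Alice to Bob. -/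
def aliceCost : {A B : Type} → [Fintype A] → [DecidableEq A] → [Fintype B] → [DecidableEq B] →
    Rounds X K A B → ℕ
  | _, _, _, _, _, _, @output _ _ _ _ _ _ _ _ _ _ => 0
  | _, _, _, _, _, _, @aliceSends _ _ _ _ _ _ _ _ _ _ _ _ q _ P => q + P.aliceCost
  | _, _, _, _, _, _, @bobSends _ _ _ _ _ _ _ _ _ _ _ _ _ _ P => P.aliceCost

/-- The unnormalized output of Bob when he plays without Alice, starting from `τ`: in place of each
message of `q` qubits he inserts `2 ^ q` times the identity, which is `4 ^ q` times the maximally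
mixed state. It dominates the output of the protocol on every input (`run_le_outputBound`). -/
noncomputable def outputBound : {A B : Type} → [Fintype A] → [DecidableEq A] → [Fintype B] →
    [DecidableEq B] → Rounds X K A B → Matrix B B ℂ → Matrix K K ℂ
  | _, _, _, _, _, _, @output _ _ _ _ _ _ _ _ _ Φ, τ => Φ.apply τ
  | _, _, _, _, _, _, @aliceSends _ _ _ _ _ _ _ _ _ _ _ _ q _ P, τ =>
      P.outputBound (2 ^ q • ((1 : Matrix (Qubits q) (Qubits q) ℂ) ⊗ₖ τ))
  | _, _, _, _, _, _, @bobSends _ _ _ _ _ _ _ _ _ _ _ _ _ Φ P, τ =>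
      P.outputBound (traceFst (Φ.apply τ))

theorem aliceCost_le_cost {A B : Type} [Fintype A] [DecidableEq A] [Fintype B] [DecidableEq B]
    (P : Rounds X K A B) : P.aliceCost ≤ P.cost := by
  induction P with
  | output => exact le_rfl
  | aliceSends q _ _ ih => exact Nat.add_le_add_left ih q
  | bobSends q _ _ ih => exact ih.trans (Nat.le_add_left _ q)

theorem trace_outputBound {A B : Type} [Fintype A] [DecidableEq A] [Fintype B] [DecidableEq B]
    (P : Rounds X K A B) (τ : Matrix B B ℂ) :
    (P.outputBound τ).trace = 4 ^ P.aliceCost * τ.trace := by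
  induction P with
  | output Φ => rw [outputBound, Φ.trace_apply, aliceCost, pow_zero, one_mul]
  | aliceSends q _ _ ih =>
    have hfour : (4 : ℂ) ^ q = 2 ^ q * 2 ^ q := by rw [← mul_pow]; norm_num
    rw [outputBound, ih, trace_smul, trace_kronecker, trace_one, aliceCost, pow_add, hfour]
    simp only [Fintype.card_fun, Fintype.card_fin, nsmul_eq_mul, Nat.cast_pow, Nat.cast_ofNat]
    ring
  | bobSends _ Φ _ ih => rw [outputBound, ih, trace_traceFst, Φ.trace_apply, aliceCost]

theorem run_le_outputBound (x : X) {A B : Type} [Fintype A] [DecidableEq A] [Fintype B]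
    [DecidableEq B] (P : Rounds X K A B) {ρ : Matrix (A × B) (A × B) ℂ} {τ : Matrix B B ℂ}
    (hρ : 0 ≤ ρ) (h : traceFst ρ ≤ τ) : P.run x ρ ≤ P.outputBound τ := by
  induction P with
  | output Φ => exact Φ.apply_mono h
  | @aliceSends A B A' _ _ _ _ _ _ q Φ _ ih =>
    set σ := reindex (Equiv.prodAssoc A' (Qubits q) B) (Equiv.prodAssoc A' (Qubits q) B)
      ((Φ x).applyFst ρ)
    have hσ : 0 ≤ σ := (((Φ x).applyFst_nonneg hρ).posSemidef.submatrix _).nonneg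
    have hBob : traceFst (traceFst σ) ≤ τ := by
      rwa [traceFst_reindex_prodAssoc, (Φ x).traceFst_applyFst]
    refine ih hσ ?_
    calc traceFst σ ≤ 2 ^ q • ((1 : Matrix (Qubits q) (Qubits q) ℂ) ⊗ₖ traceFst (traceFst σ)) := by
          simpa only [Fintype.card_fun, Fintype.card_fin] using
            le_card_smul_one_kronecker_traceFst (traceFst_nonneg hσ)
      _ ≤ 2 ^ q • ((1 : Matrix (Qubits q) (Qubits q) ℂ) ⊗ₖ τ) := by
          gcongr
          exact kronecker_le_kronecker_left PosSemidef.one.nonneg hBob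
  | bobSends _ Φ _ ih =>
    refine ih ((Φ.applySnd_nonneg hρ).posSemidef.submatrix _).nonneg ?_
    rw [traceFst_reindex_prodAssoc_symm, Φ.traceFst_applySnd]
    exact traceFst_mono (Φ.apply_mono h)

end Rounds

namespace Protocol

variable {X K : Type*} [Fintype K]

attribute [local instance] fintypeA decEqA fintypeB decEqB

/-- The number of qubits that Alice sends to Bob in the protocol. -/
def aliceCost (P : Protocol X K) : ℕ :=
  P.rounds.aliceCost

theorem aliceCost_le_cost (P : Protocol X K) : P.aliceCost ≤ P.cost :=
  P.rounds.aliceCost_le_cost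

variable [DecidableEq K]

theorem result_eq_of_solves {P : Protocol X K} {E : X → State K} (hP : P.Solves E 0) (x : X) :
    P.result x = (E x).mat := by
  refine eq_of_trace_add_trace_le_two_mul_fidelity
    (P.rounds.run_nonneg x P.shared.posSemidef.nonneg) (E x).posSemidef.nonneg ?_
  have htrace : (P.result x).trace = 1 := (P.rounds.trace_run x _).trans P.shared.trace_eq_one
  have hF := hP x
  rw [htrace, (E x).trace_eq_one, Complex.one_re]
  linarith

theorem exists_trace_eq_and_le_of_solves {P : Protocol X K} {E : X → State K}
    (hP : P.Solves E 0) : ∃ τ : Matrix K K ℂ, τ.trace = 4 ^ P.aliceCost ∧ ∀ x, (E x).mat ≤ τ := by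
  refine ⟨P.rounds.outputBound (traceFst P.shared.mat), ?_, fun x => ?_⟩
  · rw [P.rounds.trace_outputBound, trace_traceFst, P.shared.trace_eq_one, mul_one, aliceCost]
  · rw [← result_eq_of_solves hP x]
    exact P.rounds.run_le_outputBound x P.shared.posSemidef.nonneg le_rfl

end Protocol

theorem le_coe_Qpub {X K : Type*} [Fintype K] [DecidableEq K] {E : X → State K} {ε r : ℝ}
    (h : ∀ P : Protocol X K, P.Solves E ε → r ≤ P.cost) :
    (r : EReal) ≤ ((Qpub E ε : ℝ≥0∞) : EReal) := by
  have hceil : (⌈r⌉₊ : ℕ∞) ≤ Qpub E ε :=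
    le_iInf₂ fun P hP => Nat.cast_le.mpr (Nat.ceil_le.mpr (h P hP))
  calc (r : EReal) ≤ ((⌈r⌉₊ : ℝ) : EReal) := EReal.coe_le_coe_iff.mpr (Nat.le_ceil r)
    _ = (((⌈r⌉₊ : ℕ∞) : ℝ≥0∞) : EReal) := by norm_cast
    _ ≤ ((Qpub E ε : ℝ≥0∞) : EReal) :=
        EReal.coe_ennreal_le_coe_ennreal_iff.mpr (ENat.toENNReal_le.mpr hceil)

end RSP

theorem mainTheorem2_general {X K : Type*} [Fintype X] [DecidableEq X] [Fintype K] [DecidableEq K]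
    (E : X → RSP.State K) {P : RSP.Protocol X K} (hP : P.Solves E 0) :
    RSP.maxInfo E / 2 ≤ P.aliceCost := by
  obtain ⟨τ, hτ, hE⟩ := RSP.Protocol.exists_trace_eq_and_le_of_solves hP
  rw [div_le_iff₀ two_pos]
  refine Real.sSup_le ?_ (by positivity)
  rintro _ ⟨μ, hμ, rfl⟩
  have hinfo : (2 : ℝ) ^ RSP.info E μ ≤ 2 ^ (P.aliceCost * 2 : ℝ) :=
    calc (2 : ℝ) ^ RSP.info E μ ≤ τ.trace.re := RSP.two_rpow_info_le_trace E hμ hE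
      _ = 4 ^ P.aliceCost := by rw [hτ]; norm_cast
      _ = 2 ^ (P.aliceCost * 2 : ℝ) := by
        rw [mul_comm, Real.rpow_mul two_pos.le, Real.rpow_natCast]
        norm_num
  exact (Real.rpow_le_rpow_left_iff one_lt_two).mp hinfo

theorem mainTheorem2 {X K : Type*} [Fintype X] [DecidableEq X] [Fintype K] [DecidableEq K]
    (E : X → RSP.State K) :
    ((RSP.maxInfo E / 2 : ℝ) : EReal) ≤ ((RSP.Qpub E 0 : ℝ≥0∞) : EReal) :=
  RSP.le_coe_Qpub fun P hP => (mainTheorem2_general E hP).trans (mod_cast P.aliceCost_le_cost)
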